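/- Let $d \ge 2$ and let $\mathcal A = \{A_1,\ldots,A_d\}$ be a commuting family of complex $n\times n$ matrices. There is a unitary $U$ such that all $U^*A_kU$ are upper triangular, and the joint eigenvalues of $\mathcal A$ are the $n$ vectors $\boldsymbol\lambda^{(i)} = ((U^*A_1U)_{ii},\ldots,(U^*A_dU)_{ii}) \in \mathbb C^d$. Let $\boldsymbol\lambda = (\lambda_1,\ldots,\lambda_d)$ be a semisimple joint eigenvalue of multiplicity $p$, that is, $\boldsymbol\lambda$ occurs $p \ge 1$ times among the joint eigenvalues and $\dim \bigcap_k \ker(A_k - \lambda_k I_n) = p$. Suppose that $\mathcal A$ is simultaneously diagonalizable, and let $X = [X_1\ X_2]$, $Y = [Y_1\ Y_2] \in \mathbb C^{n\times n}$, with $X_1, Y_1 \in \mathbb C^{n\times p}$, be such that $$X_1^*X_1 = I_p, \qquad Y^*X = I_n, \qquad Y^*A_kX = \begin{bmatrix} \lambda_k I_p & 0\\ 0 & A_{22}^{(k)}\end{bmatrix} \text{ is diagonal},\quad k = 1,\ldots,d.$$ Let $E_1,\ldots,E_d \in \mathbb C^{n\times n}$ satisfy $\|E_1\|_F^2 + \cdots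 + \|E_d\|_F^2 = 1$. For $\epsilon > 0$ put $\widetilde A_k = A_k + \epsilon E_k$, and for $\mu \in \mathbb C^d$ put $\widetilde A(\mu) = \sum_k \mu_k \widetilde A_k$ and $\lambda(\mu) = \sum_k \mu_k\lambda_k$. Whenever the $p$ eigenvalues of $\widetilde A(\mu)$ (counted with algebraic multiplicity) closest to $\lambda(\mu)$ are semisimple, let $\widetilde X_1 = [\widetilde x_1 \cdots \widetilde x_p]$ and $\widetilde Y_1 = [\widetilde y_1 \cdots \widetilde y_p]$ contain corresponding right and left eigenvectors of $\widetilde A(\mu)$, normalized such that $\widetilde Y_1^*\widetilde X_1 = I_p$ and $\|\widetilde x_i\|_2 = 1$, and put $\widetilde{\boldsymbol\lambda}_{\mathrm{RQ1}}^{(i)} = (\widetilde x_i^*\widetilde A_1\widetilde x_i, \ldots, \widetilde x_i^*\widetilde A_d\widetilde x_i)$. Let $\mu$ be uniformly distributed on the unit sphere of $\mathbb C^d$. Then for every $R > 0$ and every $i = 1,\ldots,p$, $$\mathrm{Prob}\Big( \big\|\widetilde{\boldsymbol\lambda}_{\mathrm{RQ1}}^{(i)} - \boldsymbol\lambda\big\|_2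 \le (1 + \|X_2\|_2\|Y_2\|_2 R)\,\epsilon + \mathcal O(\epsilon^2)\Big) \ge 1 - \frac{(n-p)(d-1)d}{R^2},$$ where $\|\cdot\|_2$ is the Euclidean norm of vectors and the spectral norm of matrices, and the event means: there is a constant $C_\mu$, which may depend on $\mu$ but not on $\epsilon$, such that for every $\epsilon > 0$ and every such choice of eigenvectors the error is at most $(1 + \|X_2\|_2\|Y_2\|_2R)\,\epsilon + C_\mu\epsilon^2$. -/

import Mathlib

open scoped Matrix Matrix.Norms.L2Operator

noncomputable section

namespace JointEig

open Matrix MeasureTheory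

/-- The uniform probability distribution on the unit sphere of `ℂ^d`: surface measure, normalized
to total mass one. -/
def unifSphere (d : ℕ) : Measure (Metric.sphere (0 : EuclideanSpace ℂ (Fin d)) 1) :=
  ((volume : Measure (EuclideanSpace ℂ (Fin d))).toSphere Set.univ)⁻¹ •
    (volume : Measure (EuclideanSpace ℂ (Fin d))).toSphere

/-- The linear combination `A(μ) = μ₁ A₁ + ⋯ + μ_d A_d`. -/
def linComb {n d : ℕ} (A : Fin d → Matrix (Fin n) (Fin n) ℂ) (μ : EuclideanSpace ℂ (Fin d)) :
    Matrix (Fin n) (Fin n) ℂ :=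
  ∑ k, μ k • A k

/-- The linear combination `λ(μ) = μ₁ λ₁ + ⋯ + μ_d λ_d`. -/
def linCombEig {d : ℕ} (lam μ : EuclideanSpace ℂ (Fin d)) : ℂ :=
  ∑ k, μ k * lam k

/-- The perturbed family `A_k + ε E_k`. -/
def perturbed {n d : ℕ} (A E : Fin d → Matrix (Fin n) (Fin n) ℂ) (ε : ℝ) :
    Fin d → Matrix (Fin n) (Fin n) ℂ :=
  fun k => A k + (ε : ℂ) • E k

/-- `jointEigs` is the list of the `n` joint eigenvalues of the family `A`: there is a unitary `U`
such that every `U* A_k U` is upper triangular, and the `i`-th joint eigenvalue consists of the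
`i`-th diagonal entries of `U* A_1 U, …, U* A_d U`. -/
def IsJointEigenvalueList {n d : ℕ} (A : Fin d → Matrix (Fin n) (Fin n) ℂ)
    (jointEigs : Fin n → EuclideanSpace ℂ (Fin d)) : Prop :=
  ∃ U ∈ Matrix.unitaryGroup (Fin n) ℂ,
    (∀ k, (Uᴴ * A k * U).BlockTriangular id) ∧
    ∀ i k, jointEigs i k = (Uᴴ * A k * U) i i

/-- The common eigenspace `⋂ₖ ker (A_k - λ_k I)`. -/
def commonEigenspace {n d : ℕ} (A : Fin d → Matrix (Fin n) (Fin n) ℂ)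
    (lam : EuclideanSpace ℂ (Fin d)) : Submodule ℂ (Fin n → ℂ) :=
  ⨅ k, LinearMap.ker (Matrix.toLin' (A k - lam k • (1 : Matrix (Fin n) (Fin n) ℂ)))

/-- `lam` is a semisimple joint eigenvalue of multiplicity `p`: it occurs `p ≥ 1` times in the list
of joint eigenvalues, and the common eigenspace has dimension `p` as well. -/
structure IsSemisimpleJointEigenvalue {n d : ℕ} (A : Fin d → Matrix (Fin n) (Fin n) ℂ)
    (lam : EuclideanSpace ℂ (Fin d)) (p : ℕ) : Prop where
  pos : 0 < p
  algebraic : ∃ jointEigs : Fin n → EuclideanSpace ℂ (Fin d),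
    IsJointEigenvalueList A jointEigs ∧ {i | jointEigs i = lam}.ncard = p
  geometric : Module.finrank ℂ (commonEigenspace A lam) = p

/-- `X = [X₁ X₂]` and `Y = [Y₁ Y₂]` satisfy `X₁* X₁ = I`, `Y* X = I` and
`Y* A_k X = [λ_k I, 0; 0, A₂₂⁽ᵏ⁾]` for all `k`. -/
structure IsBlockDiagonalization {n d p : ℕ} (A : Fin d → Matrix (Fin n) (Fin n) ℂ)
    (lam : EuclideanSpace ℂ (Fin d)) (X₁ Y₁ : Matrix (Fin n) (Fin p) ℂ)
    (X₂ Y₂ : Matrix (Fin n) (Fin (n - p)) ℂ) : Prop where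
  orthonormal : X₁ᴴ * X₁ = 1
  biorthogonal : (fromCols Y₁ Y₂)ᴴ * fromCols X₁ X₂ = 1
  block : ∀ k, ∃ A₂₂ : Matrix (Fin (n - p)) (Fin (n - p)) ℂ,
    (fromCols Y₁ Y₂)ᴴ * A k * fromCols X₁ X₂ = fromBlocks (lam k • 1) 0 0 A₂₂

/-- `θ` is an eigenvalue of `M` whose algebraic and geometric multiplicities agree. -/
def IsSemisimpleEigenvalue {n : ℕ} (M : Matrix (Fin n) (Fin n) ℂ) (θ : ℂ) : Prop :=
  M.charpoly.IsRoot θ ∧ M.charpoly.rootMultiplicity θ =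
    Module.finrank ℂ (LinearMap.ker (Matrix.toLin' (M - θ • (1 : Matrix (Fin n) (Fin n) ℂ))))

/-- `θ₁, …, θ_p` are `p` eigenvalues of `M`, counted with algebraic multiplicity, that are closest
to `z` (in the case of a tie, any admissible choice): none of the remaining eigenvalues is closer
to `z`. -/
def AreClosestEigenvalues {n p : ℕ} (M : Matrix (Fin n) (Fin n) ℂ) (z : ℂ) (θ : Fin p → ℂ) :
    Prop :=
  ∃ rest : Multiset ℂ, M.charpoly.roots = Finset.univ.val.map θ + rest ∧
    ∀ i, ∀ w ∈ rest, ‖θ i - z‖ ≤ ‖w - z‖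

/-- The `p` eigenvalues of `M` closest to `z` are semisimple, and the columns of `Xt` and `Yt` are
corresponding right and left eigenvectors, normalized such that `Yt* Xt = I` and the columns of
`Xt` have norm one. -/
structure IsClosestEigenbasis {n p : ℕ} (M : Matrix (Fin n) (Fin n) ℂ) (z : ℂ)
    (Xt Yt : Matrix (Fin n) (Fin p) ℂ) (θ : Fin p → ℂ) : Prop where
  closest : AreClosestEigenvalues M z θ
  semisimple : ∀ i, IsSemisimpleEigenvalue M (θ i)
  right : M * Xt = Xt * diagonal θ
  left : Ytᴴ * M = diagonal θ * Ytᴴ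
  biorthogonal : Ytᴴ * Xt = 1
  norm_col : ∀ i, ‖WithLp.toLp 2 (Xt.col i)‖ = 1

/-- The one-sided Rayleigh quotient `(x* A_1 x, …, x* A_d x)`. -/
def rq1 {n d : ℕ} (A : Fin d → Matrix (Fin n) (Fin n) ℂ) (x : Fin n → ℂ) :
    EuclideanSpace ℂ (Fin d) :=
  WithLp.toLp 2 fun k => star x ⬝ᵥ (A k *ᵥ x)

end JointEig

end

noncomputable section

namespace JointEig

open Matrix MeasureTheory

/-! Write a unit eigenvector `x` of `Ã(μ)`, with eigenvalue `θ`, as `X₁ a + X₂ b`, where `a = Y₁* x`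
and `b = Y₂* x`. Let `D j` be the joint eigenvalues in the second block and `w = X₂* x`. The
Rayleigh quotient error of the unperturbed family is the sum of `conj (w j) * b j * (D j - λ)`
(`rq1_sub`). Applying `Y₂*` to the eigenvector equation gives `(D j - λ)(μ) * b j = τ * b j - ε * c
j` with `τ = θ - λ(μ)` and `c = Y₂* E(μ) x`. If `‖D j - λ‖ ≤ R * |(D j - λ)(μ)|` for every `j`, the
possibly small divisor `(D j - λ)(μ)` cancels from the error. Cauchy–Schwarz then bounds it by `‖X₂‖
‖Y₂‖ R ε` plus a term in `τ * b`, which is second order because `τ` and `b` are both `O(ε)`. The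
term `ε E` in the Rayleigh quotient adds at most `ε`. No power series expansion of eigenvectors is
needed (`norm_rq1_sub_le`).

The estimate requires `θ` to stay well inside the spectral gap. The eigenvalue `λ(μ)` of `A(μ)` has
multiplicity at least `p`, so for small `ε` a small disc around it contains at least `p` eigenvalues
of `Ã(μ)`, hence the `p` closest ones. For the remaining `ε`, bounded away from zero, a crude bound
is absorbed into `C ε²`.

A direction `μ` is bad for `j` when it lies in a slab of half-width `1 / R` on the sphere, an event
of probability at most `d / R²`. The union bound over the `n - p` indices gives `(n - p) d / R²`,
which suffices since `d - 1 ≥ 1`. -/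

/-! ### Persistence of eigenvalues in a disc. -/

open Filter Topology Polynomial in
/-- Lower semicontinuity of the number of eigenvalues in a disc. -/
theorem eventually_rootMultiplicity_le_countP {n : ℕ} (M : ℝ → Matrix (Fin n) (Fin n) ℂ)
    (hM : Continuous M) (z : ℂ) {r : ℝ} (hr : 0 < r) :
    ∀ᶠ ε in 𝓝 (0 : ℝ), (M 0).charpoly.rootMultiplicity z ≤
      (M ε).charpoly.roots.countP (fun w => ‖w - z‖ < r) := by
  have key : ∀ N : Matrix (Fin n) (Fin n) ℂ, ∃ w : Fin n → ℂ,
      N.charpoly.roots = Finset.univ.val.map w := by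
    intro N
    have hc : N.charpoly.roots.card = n := by
      rw [← (IsAlgClosed.splits N.charpoly).natDegree_eq_card_roots, charpoly_natDegree_eq_dim,
        Fintype.card_fin]
    obtain ⟨l, hl⟩ := Quot.exists_rep N.charpoly.roots
    have hl' : l.length = n := by rw [← hc, ← hl]; rfl
    subst hl'
    refine ⟨l.get, ?_⟩
    rw [← hl, Fin.univ_val_map, List.ofFn_get]
    rfl
  choose w hw using key
  have heval : ∀ (a : Fin n → ℂ) (t : ℂ),
      ((Finset.univ.val.map a).map fun b => X - C b).prod.eval t = ∏ i, (t - a i) := by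
    intro a t
    rw [Multiset.map_map]
    change (∏ i, (X - C (a i))).eval t = _
    simp [eval_prod]
  have hprod : ∀ N t, N.charpoly.eval t = ∏ i, (t - w N i) := by
    intro N t
    conv_lhs => rw [(IsAlgClosed.splits N.charpoly).eq_prod_roots_of_monic N.charpoly_monic, hw N]
    exact heval _ _
  have hbd : ∀ N i, ‖w N i‖ ≤ ‖N‖ * ‖(1 : Matrix (Fin n) (Fin n) ℂ)‖ := by
    intro N i
    apply spectrum.norm_le_norm_mul_of_mem (𝕜 := ℂ)
    rw [Matrix.mem_spectrum_iff_isRoot_charpoly]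
    have : w N i ∈ N.charpoly.roots := by rw [hw N]; simp
    exact (mem_roots'.1 this).2
  -- Compactness: along a sequence of counterexamples tending to zero the eigenvalue tuples are
  -- bounded, so a subsequence converges to some `a`. Passing to the limit in the characteristic
  -- polynomials shows that `a` lists the eigenvalues of `M 0`.
  by_contra hcon
  obtain ⟨e, he, hne⟩ := exists_seq_forall_of_frequently (not_eventually.1 hcon)
  have hMe : Tendsto (fun m => M (e m)) atTop (𝓝 (M 0)) := (hM.tendsto 0).comp he
  obtain ⟨B, hB⟩ := (Metric.isBounded_range_of_tendsto _ hMe).exists_norm_le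
  obtain ⟨a, -, φ, hφ, ha⟩ := tendsto_subseq_of_bounded
    (s := Metric.closedBall (0 : Fin n → ℂ) (B * ‖(1 : Matrix (Fin n) (Fin n) ℂ)‖))
    Metric.isBounded_closedBall (x := fun m => w (M (e m))) (by
      intro m
      have hBm := hB (M (e m)) ⟨m, rfl⟩
      rw [mem_closedBall_zero_iff, pi_norm_le_iff_of_nonneg
        (mul_nonneg ((norm_nonneg _).trans hBm) (norm_nonneg _))]
      intro i
      exact (hbd _ i).trans (by gcongr))
  have ha' : ∀ i, Tendsto (fun m => w (M (e (φ m))) i) atTop (𝓝 (a i)) := tendsto_pi_nhds.1 ha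
  have hMφ := hMe.comp hφ.tendsto_atTop
  have hchar : (M 0).charpoly = (Multiset.map (fun b => X - C b) (Finset.univ.val.map a)).prod := by
    apply Polynomial.funext
    intro t
    have h1 : Tendsto (fun m => (M (e (φ m))).charpoly.eval t) atTop
        (𝓝 ((M 0).charpoly.eval t)) := by
      simp only [eval_charpoly]
      have hc : Continuous fun N : Matrix (Fin n) (Fin n) ℂ => (scalar (Fin n) t - N).det :=
        (continuous_const.sub continuous_id).matrix_det
      exact (hc.tendsto _).comp hMφ
    have h2 : Tendsto (fun m => (M (e (φ m))).charpoly.eval t) atTop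
        (𝓝 (∏ i, (t - a i))) := by
      simp only [hprod]
      exact tendsto_finsetProd _ fun i _ => tendsto_const_nhds.sub (ha' i)
    rw [tendsto_nhds_unique h1 h2, heval]
  have hroots : (M 0).charpoly.roots = Finset.univ.val.map a := by
    rw [hchar, roots_multiset_prod_X_sub_C]
  have hev : ∀ᶠ m in atTop, ∀ i, a i = z → ‖w (M (e (φ m))) i - z‖ < r := by
    rw [eventually_all]
    intro i
    by_cases h : a i = z
    · have h3 := (ha' i).sub_const z
      rw [h, sub_self] at h3
      filter_upwards [(tendsto_zero_iff_norm_tendsto_zero.1 h3).eventually_lt_const hr] with m hm _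
      exact hm
    · simp [h]
  obtain ⟨m, hm⟩ := hev.exists
  apply hne (φ m)
  classical
  rw [← count_roots, hroots, hw (M (e (φ m))), Multiset.count, Multiset.countP_map,
    Multiset.countP_map]
  apply Multiset.card_le_card
  exact Multiset.monotone_filter_right _ fun i hi => hm i hi.symm

/-! ### Slabs in the ball and on the sphere of `ℂ^d`. -/

theorem volume_sum_sq_lt_one (m : ℕ) :
    volume {x : Fin m → ℂ | ∑ i, ‖x i‖ ^ 2 < 1} =
      ENNReal.ofReal (Real.pi ^ m / m.factorial) := by
  have h := Complex.volume_sum_rpow_lt_one (Fin m) (p := 2) (by norm_num)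
  simp only [Real.rpow_two, Fintype.card_fin] at h
  rw [h, div_self two_ne_zero, one_add_one_eq_two, Real.Gamma_two, mul_one,
    mul_div_cancel_left₀ _ two_ne_zero, Real.Gamma_nat_eq_factorial]

/-- The part of the unit ball of `ℂ^(m+1)` in a slab of half-width `t`. -/
theorem volume_pi_slab_le (m : ℕ) {t : ℝ} (ht : 0 ≤ t) :
    volume {x : Fin (m + 1) → ℂ | ∑ i, ‖x i‖ ^ 2 < 1 ∧ ‖x 0‖ < t} ≤
      ENNReal.ofReal ((m + 1) * t ^ 2) *
        volume {x : Fin (m + 1) → ℂ | ∑ i, ‖x i‖ ^ 2 < 1} := by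
  -- The slab is enclosed in a disc times the unit ball of `ℂ^m`. The factor `m + 1` is the ratio of
  -- `π * π^m / m!` to `π^(m+1) / (m+1)!`.
  have hsub : {x : Fin (m + 1) → ℂ | ∑ i, ‖x i‖ ^ 2 < 1 ∧ ‖x 0‖ < t} ⊆
      MeasurableEquiv.piFinSuccAbove (fun _ : Fin (m + 1) => ℂ) 0 ⁻¹'
        (Metric.ball (0 : ℂ) t ×ˢ {y : Fin m → ℂ | ∑ i, ‖y i‖ ^ 2 < 1}) := by
    rintro x ⟨h1, h2⟩
    rw [Fin.sum_univ_succ] at h1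
    refine ⟨by simpa using h2, ?_⟩
    have h3 : ∑ i : Fin m, ‖x i.succ‖ ^ 2 < 1 := by nlinarith [sq_nonneg ‖x 0‖]
    simpa [MeasurableEquiv.piFinSuccAbove, Fin.tail] using h3
  refine (measure_mono hsub).trans ?_
  have hmeas : MeasurableSet {y : Fin m → ℂ | ∑ i, ‖y i‖ ^ 2 < 1} :=
    measurableSet_lt (by fun_prop) measurable_const
  rw [(volume_preserving_piFinSuccAbove (fun _ : Fin (m + 1) => ℂ) 0).measure_preimage
      (measurableSet_ball.prod hmeas).nullMeasurableSet,
    Measure.volume_eq_prod, Measure.prod_prod, volume_sum_sq_lt_one, volume_sum_sq_lt_one,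
    Complex.volume_ball, ← ENNReal.ofReal_mul (by positivity), ← ENNReal.ofReal_pow ht,
    ← ENNReal.ofReal_coe_nnreal, NNReal.coe_real_pi, ← ENNReal.ofReal_mul (by positivity),
    ← ENNReal.ofReal_mul (by positivity)]
  refine ENNReal.ofReal_le_ofReal (le_of_eq ?_)
  rw [Nat.factorial_succ]
  push_cast
  field_simp
  ring

/-- Reduces to the coordinate slab by completing `u` to an orthonormal basis. The coordinate map
pushes volume to some multiple of volume; the multiple occurs on both sides, so its value is
irrelevant. -/
theorem volume_slab_le {m : ℕ} {u : EuclideanSpace ℂ (Fin (m + 1))} (hu : ‖u‖ = 1) {t : ℝ}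
    (ht : 0 ≤ t) :
    volume {x : EuclideanSpace ℂ (Fin (m + 1)) | ‖x‖ < 1 ∧ ‖inner ℂ u x‖ < t} ≤
      ENNReal.ofReal ((m + 1) * t ^ 2) *
        volume (Metric.ball (0 : EuclideanSpace ℂ (Fin (m + 1))) 1) := by
  have hort : Orthonormal ℂ (({0} : Set (Fin (m + 1))).domRestrict fun _ => u) := by
    refine ⟨fun i => hu, fun i j hij => (hij (Subsingleton.elim i j)).elim⟩
  obtain ⟨b, hb⟩ := hort.exists_orthonormalBasis_extension_of_card_eq (by simp)
  have hb0 : b 0 = u := hb 0 rfl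
  let L : EuclideanSpace ℂ (Fin (m + 1)) ≃L[ℂ] (Fin (m + 1) → ℂ) :=
    b.repr.toContinuousLinearEquiv.trans (EuclideanSpace.equiv (Fin (m + 1)) ℂ)
  have hL : ∀ x i, L x i = inner ℂ (b i) x := fun x i => b.repr_apply_apply x i
  have hnorm : ∀ x, ∑ i, ‖L x i‖ ^ 2 = ‖x‖ ^ 2 := by
    intro x
    simp only [hL]
    exact b.sum_sq_norm_inner_right x
  have hlt : ∀ x, ∑ i, ‖L x i‖ ^ 2 < 1 ↔ ‖x‖ < 1 := by
    intro x
    rw [hnorm, sq_lt_one_iff₀ (norm_nonneg x)]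
  set ν := Measure.map L (volume : Measure (EuclideanSpace ℂ (Fin (m + 1)))) with hν
  have : ν.IsAddHaarMeasure := L.isAddHaarMeasure_map _
  have hνv : ν = ν.addHaarScalarFactor volume • volume :=
    Measure.isAddLeftInvariant_eq_smul ν volume
  have hmap : ∀ s : Set (Fin (m + 1) → ℂ), ν s = volume (L ⁻¹' s) := fun s =>
    L.toHomeomorph.toMeasurableEquiv.map_apply s
  have h1 : {x : EuclideanSpace ℂ (Fin (m + 1)) | ‖x‖ < 1 ∧ ‖inner ℂ u x‖ < t} =
      L ⁻¹' {x | ∑ i, ‖x i‖ ^ 2 < 1 ∧ ‖x 0‖ < t} := by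
    ext x
    rw [Set.mem_preimage, Set.mem_ofPred_eq, Set.mem_ofPred_eq, hlt, hL, hb0]
  have h2 : Metric.ball (0 : EuclideanSpace ℂ (Fin (m + 1))) 1 =
      L ⁻¹' {x | ∑ i, ‖x i‖ ^ 2 < 1} := by
    ext x
    simp only [Set.mem_ofPred_eq, Set.mem_preimage, hlt, mem_ball_zero_iff]
  rw [h1, h2, ← hmap, ← hmap, hνv, Measure.smul_apply, Measure.smul_apply, mul_smul_comm]
  exact smul_le_smul_of_nonneg_left (volume_pi_slab_le m ht) (zero_le)

theorem isProbabilityMeasure_unifSphere {d : ℕ} (hd : 0 < d) :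
    IsProbabilityMeasure (unifSphere d) := by
  have : Nonempty (Fin d) := ⟨⟨0, hd⟩⟩
  constructor
  rw [unifSphere, Measure.smul_apply, smul_eq_mul]
  refine ENNReal.inv_mul_cancel ?_ (measure_ne_top _ _)
  rw [Measure.measure_univ_ne_zero]
  exact Measure.toSphere_ne_zero _

-- Surface measure is the real dimension times the volume of the cone over a set. Shrinking a vector
-- shrinks its inner product with `u`, so the cone over a spherical slab lies in the solid slab of
-- the same width.
open scoped Pointwise in
theorem unifSphere_slab_le {d : ℕ} (hd : 0 < d) {u : EuclideanSpace ℂ (Fin d)} (hu : ‖u‖ = 1)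
    {t : ℝ} (ht : 0 ≤ t) :
    (unifSphere d).real {μ | ‖inner ℂ u (μ : EuclideanSpace ℂ (Fin d))‖ < t} ≤ d * t ^ 2 := by
  obtain ⟨m, rfl⟩ : ∃ m, d = m + 1 := ⟨d - 1, by omega⟩
  have := isProbabilityMeasure_unifSphere hd
  refine ENNReal.toReal_le_of_le_ofReal (by positivity) ?_
  have hms : MeasurableSet {μ : Metric.sphere (0 : EuclideanSpace ℂ (Fin (m + 1))) 1 |
      ‖inner ℂ u (μ : EuclideanSpace ℂ (Fin (m + 1)))‖ < t} :=
    (isOpen_lt (by fun_prop) continuous_const).measurableSet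
  rw [unifSphere, Measure.smul_apply, smul_eq_mul, Measure.toSphere_apply' _ hms,
    Measure.toSphere_apply_univ]
  set D : ENNReal := (Module.finrank ℝ (EuclideanSpace ℂ (Fin (m + 1))) : ENNReal) with hD
  set V := volume (Metric.ball (0 : EuclideanSpace ℂ (Fin (m + 1))) 1) with hV
  have hD0 : D ≠ 0 := by
    rw [hD, Nat.cast_ne_zero]
    exact Module.finrank_pos.ne'
  have hDt : D ≠ ⊤ := ENNReal.natCast_ne_top _
  have hV0 : V ≠ 0 := (Metric.measure_ball_pos _ _ one_pos).ne'
  have hVt : V ≠ ⊤ := measure_ball_lt_top.ne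
  have hsub : Set.Ioo (0 : ℝ) 1 • (Subtype.val ''
      {μ : Metric.sphere (0 : EuclideanSpace ℂ (Fin (m + 1))) 1 |
        ‖inner ℂ u (μ : EuclideanSpace ℂ (Fin (m + 1)))‖ < t}) ⊆
      {x : EuclideanSpace ℂ (Fin (m + 1)) | ‖x‖ < 1 ∧ ‖inner ℂ u x‖ < t} := by
    rintro _ ⟨s, ⟨hs0, hs1⟩, _, ⟨μ, hμ, rfl⟩, rfl⟩
    have hμ1 : ‖(μ : EuclideanSpace ℂ (Fin (m + 1)))‖ = 1 := by simp
    have hμt : ‖inner ℂ u (μ : EuclideanSpace ℂ (Fin (m + 1)))‖ < t := hμ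
    constructor
    · simp only [norm_smul, hμ1, mul_one, Real.norm_eq_abs, abs_of_pos hs0, hs1]
    · have : inner ℂ u (s • (μ : EuclideanSpace ℂ (Fin (m + 1)))) = (s : ℂ) * inner ℂ u (μ : EuclideanSpace ℂ (Fin (m + 1))) := by
        rw [← inner_smul_right]; rfl
      simp only [this, norm_mul, Complex.norm_real, Real.norm_eq_abs, abs_of_pos hs0]
      nlinarith [norm_nonneg (inner ℂ u (μ : EuclideanSpace ℂ (Fin (m + 1))))]
  calc (D * V)⁻¹ * (D * volume _) ≤ (D * V)⁻¹ * (D * (ENNReal.ofReal ((m + 1) * t ^ 2) * V)) := by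
        gcongr
        exact (measure_mono hsub).trans (volume_slab_le hu ht)
    _ = ENNReal.ofReal ((m + 1) * t ^ 2) * ((D * V)⁻¹ * (D * V)) := by ring
    _ = ENNReal.ofReal (((m + 1 : ℕ) : ℝ) * t ^ 2) := by
        rw [ENNReal.inv_mul_cancel (mul_ne_zero hD0 hV0) (ENNReal.mul_ne_top hDt hVt), mul_one]
        push_cast
        rfl

/-! ### Norm estimates for the perturbation and the Rayleigh quotient. -/

theorem norm_toLp_mulVec_le {m n : ℕ} (M : Matrix (Fin m) (Fin n) ℂ) (v : Fin n → ℂ) :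
    ‖WithLp.toLp 2 (M *ᵥ v)‖ ≤ ‖M‖ * ‖WithLp.toLp 2 v‖ :=
  l2_opNorm_mulVec M (WithLp.toLp 2 v)

theorem norm_star_dotProduct_le {n : ℕ} (v w : Fin n → ℂ) :
    ‖star v ⬝ᵥ w‖ ≤ ‖WithLp.toLp 2 v‖ * ‖WithLp.toLp 2 w‖ := by
  have h := norm_inner_le_norm (𝕜 := ℂ) (WithLp.toLp 2 v) (WithLp.toLp 2 w)
  rwa [EuclideanSpace.inner_toLp_toLp, dotProduct_comm] at h

theorem star_dotProduct_self {n : ℕ} {v : Fin n → ℂ} (hv : ‖WithLp.toLp 2 v‖ = 1) :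
    star v ⬝ᵥ v = 1 := by
  have h := inner_self_eq_norm_sq_to_K (𝕜 := ℂ) (WithLp.toLp 2 v)
  rw [EuclideanSpace.inner_toLp_toLp, dotProduct_comm, hv] at h
  simpa using h

theorem sum_norm_mul_norm_le {m : ℕ} (v w : Fin m → ℂ) :
    ∑ j, ‖v j‖ * ‖w j‖ ≤ ‖WithLp.toLp 2 v‖ * ‖WithLp.toLp 2 w‖ := by
  rw [EuclideanSpace.norm_eq, EuclideanSpace.norm_eq]
  exact Real.sum_mul_le_sqrt_mul_sqrt _ _ _

theorem norm_mulVec_sq_le_frobenius {m n : ℕ} (M : Matrix (Fin m) (Fin n) ℂ) (v : Fin n → ℂ) :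
    ‖WithLp.toLp 2 (M *ᵥ v)‖ ^ 2 ≤ (∑ r, ∑ s, ‖M r s‖ ^ 2) * ‖WithLp.toLp 2 v‖ ^ 2 := by
  rw [EuclideanSpace.norm_sq_eq, EuclideanSpace.norm_sq_eq, Finset.sum_mul]
  refine Finset.sum_le_sum fun r _ => ?_
  refine le_trans ?_ (Finset.sum_mul_sq_le_sq_mul_sq Finset.univ (fun s => ‖M r s‖) fun s => ‖v s‖)
  refine pow_le_pow_left₀ (norm_nonneg _) ?_ 2
  change ‖∑ s, M r s * v s‖ ≤ _
  refine (norm_sum_le _ _).trans (le_of_eq ?_)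
  simp only [norm_mul]

section

variable {n d p : ℕ}

theorem sum_norm_mulVec_sq_le {E : Fin d → Matrix (Fin n) (Fin n) ℂ}
    (hE : ∑ k, ∑ r, ∑ s, ‖E k r s‖ ^ 2 = 1) {x : Fin n → ℂ} (hx : ‖WithLp.toLp 2 x‖ = 1) :
    ∑ k, ‖WithLp.toLp 2 (E k *ᵥ x)‖ ^ 2 ≤ 1 := by
  rw [← hE]
  refine Finset.sum_le_sum fun k _ => ?_
  simpa [hx] using norm_mulVec_sq_le_frobenius (E k) x

theorem linComb_mulVec (E : Fin d → Matrix (Fin n) (Fin n) ℂ) (μ : EuclideanSpace ℂ (Fin d))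
    (x : Fin n → ℂ) : linComb E μ *ᵥ x = ∑ k, μ k • (E k *ᵥ x) := by
  simp only [linComb, Matrix.sum_mulVec, smul_mulVec]

theorem norm_linComb_mulVec_le {E : Fin d → Matrix (Fin n) (Fin n) ℂ}
    (hE : ∑ k, ∑ r, ∑ s, ‖E k r s‖ ^ 2 = 1) {x : Fin n → ℂ} (hx : ‖WithLp.toLp 2 x‖ = 1)
    {μ : EuclideanSpace ℂ (Fin d)} (hμ : ‖μ‖ = 1) :
    ‖WithLp.toLp 2 (linComb E μ *ᵥ x)‖ ≤ 1 := by
  rw [linComb_mulVec, WithLp.toLp_sum]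
  refine (norm_sum_le _ _).trans ?_
  simp only [WithLp.toLp_smul, norm_smul]
  refine (Real.sum_mul_le_sqrt_mul_sqrt _ _ _).trans ?_
  rw [← EuclideanSpace.norm_eq, hμ, one_mul, Real.sqrt_le_one]
  exact sum_norm_mulVec_sq_le hE hx

theorem norm_rq1_le {E : Fin d → Matrix (Fin n) (Fin n) ℂ}
    (hE : ∑ k, ∑ r, ∑ s, ‖E k r s‖ ^ 2 = 1) {x : Fin n → ℂ} (hx : ‖WithLp.toLp 2 x‖ = 1) :
    ‖rq1 E x‖ ≤ 1 := by
  rw [EuclideanSpace.norm_eq, Real.sqrt_le_one]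
  refine (Finset.sum_le_sum fun k _ => ?_).trans (sum_norm_mulVec_sq_le hE hx)
  refine pow_le_pow_left₀ (norm_nonneg _) ?_ 2
  simpa [hx, rq1] using norm_star_dotProduct_le x (E k *ᵥ x)

theorem rq1_perturbed (A E : Fin d → Matrix (Fin n) (Fin n) ℂ) (ε : ℝ) (x : Fin n → ℂ) :
    rq1 (perturbed A E ε) x = rq1 A x + (ε : ℂ) • rq1 E x := by
  ext k
  simp [rq1, perturbed, add_mulVec, smul_mulVec]

theorem norm_rq1_perturbed_sub_le (A : Fin d → Matrix (Fin n) (Fin n) ℂ)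
    {E : Fin d → Matrix (Fin n) (Fin n) ℂ}
    (hE : ∑ k, ∑ r, ∑ s, ‖E k r s‖ ^ 2 = 1) (lam : EuclideanSpace ℂ (Fin d)) {ε : ℝ} (hε : 0 ≤ ε)
    {x : Fin n → ℂ} (hx : ‖WithLp.toLp 2 x‖ = 1) :
    ‖rq1 (perturbed A E ε) x - lam‖ ≤ ‖rq1 A x - lam‖ + ε := by
  rw [rq1_perturbed, add_sub_right_comm]
  refine (norm_add_le _ _).trans (add_le_add le_rfl ?_)
  rw [norm_smul, Complex.norm_real, Real.norm_of_nonneg hε]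
  exact mul_le_of_le_one_right hε (norm_rq1_le hE hx)

theorem norm_rq1_sub_le_sum (A : Fin d → Matrix (Fin n) (Fin n) ℂ)
    (lam : EuclideanSpace ℂ (Fin d)) {x : Fin n → ℂ} (hx : ‖WithLp.toLp 2 x‖ = 1) :
    ‖rq1 A x - lam‖ ≤ (∑ k, ‖A k‖) + ‖lam‖ := by
  refine (norm_sub_le _ _).trans (add_le_add ?_ le_rfl)
  rw [EuclideanSpace.norm_eq]
  refine (Real.sqrt_le_sqrt (Finset.sum_le_sum fun k _ => pow_le_pow_left₀ (norm_nonneg _)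
    (?_ : _ ≤ ‖A k‖) 2)).trans ?_
  · refine (norm_star_dotProduct_le _ _).trans ?_
    rw [hx, one_mul]
    simpa [hx] using norm_toLp_mulVec_le (A k) x
  · refine Real.sqrt_le_iff.2 ⟨Finset.sum_nonneg fun _ _ => norm_nonneg _, ?_⟩
    exact Finset.sum_sq_le_sq_sum_of_nonneg fun _ _ => norm_nonneg _

theorem linComb_perturbed (A E : Fin d → Matrix (Fin n) (Fin n) ℂ) (ε : ℝ)
    (μ : EuclideanSpace ℂ (Fin d)) :
    linComb (perturbed A E ε) μ = linComb A μ + (ε : ℂ) • linComb E μ := by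
  simp only [linComb, perturbed, smul_add, Finset.sum_add_distrib, Finset.smul_sum]
  congr 1
  exact Finset.sum_congr rfl fun k _ => smul_comm _ _ _

theorem linCombEig_sub (l m μ : EuclideanSpace ℂ (Fin d)) :
    linCombEig (l - m) μ = linCombEig l μ - linCombEig m μ := by
  simp [linCombEig, mul_sub, Finset.sum_sub_distrib]

/-- A simultaneous diagonalization of `A`, split into the eigenvalue `lam` and the joint
eigenvalues `D j`. -/
structure IsDiagonalSplitting (A : Fin d → Matrix (Fin n) (Fin n) ℂ)
    (lam : EuclideanSpace ℂ (Fin d)) (X₁ Y₁ : Matrix (Fin n) (Fin p) ℂ)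
    (X₂ Y₂ : Matrix (Fin n) (Fin (n - p)) ℂ)
    (D : Fin (n - p) → EuclideanSpace ℂ (Fin d)) : Prop where
  left₁ : ∀ k, Y₁ᴴ * A k = lam k • Y₁ᴴ
  left₂ : ∀ k, Y₂ᴴ * A k = diagonal (fun j => D j k) * Y₂ᴴ
  right₁ : ∀ k, A k * X₁ = lam k • X₁
  right₂ : ∀ k, A k * X₂ = X₂ * diagonal fun j => D j k
  resolution : X₁ * Y₁ᴴ + X₂ * Y₂ᴴ = 1

/-! ### The Rayleigh quotient error in diagonalizing coordinates. -/

namespace IsDiagonalSplitting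

variable {A E : Fin d → Matrix (Fin n) (Fin n) ℂ} {lam : EuclideanSpace ℂ (Fin d)}
  {X₁ Y₁ : Matrix (Fin n) (Fin p) ℂ} {X₂ Y₂ : Matrix (Fin n) (Fin (n - p)) ℂ}
  {D : Fin (n - p) → EuclideanSpace ℂ (Fin d)}

theorem resolution_mulVec (h : IsDiagonalSplitting A lam X₁ Y₁ X₂ Y₂ D) (x : Fin n → ℂ) :
    X₁ *ᵥ (Y₁ᴴ *ᵥ x) + X₂ *ᵥ (Y₂ᴴ *ᵥ x) = x := by
  rw [mulVec_mulVec, mulVec_mulVec, ← add_mulVec, h.resolution, one_mulVec]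

/-- `A k - lam k` annihilates the `X₁` component of `x` and scales the `j`-th coordinate along `X₂`
by `D j k - lam k`. -/
theorem rq1_sub (h : IsDiagonalSplitting A lam X₁ Y₁ X₂ Y₂ D) {x : Fin n → ℂ}
    (hx : ‖WithLp.toLp 2 x‖ = 1) :
    rq1 A x - lam = ∑ j, (star ((X₂ᴴ *ᵥ x) j) * (Y₂ᴴ *ᵥ x) j) • (D j - lam) := by
  ext k
  have h1 : A k *ᵥ x - lam k • x = X₂ *ᵥ fun j => (D j k - lam k) * (Y₂ᴴ *ᵥ x) j := by
    have h2 : A k *ᵥ x = lam k • (X₁ *ᵥ (Y₁ᴴ *ᵥ x)) +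
        X₂ *ᵥ (diagonal (fun j => D j k) *ᵥ (Y₂ᴴ *ᵥ x)) := by
      conv_lhs => rw [← h.resolution_mulVec x]
      rw [mulVec_add, mulVec_mulVec, h.right₁, mulVec_mulVec _ (A k) X₂, h.right₂, smul_mulVec,
        ← mulVec_mulVec]
    conv_lhs => rw [h2]; rhs; rw [← h.resolution_mulVec x]
    rw [smul_add, add_sub_add_left_eq_sub, ← mulVec_smul, ← mulVec_sub]
    congr 1
    ext j
    rw [Pi.sub_apply, mulVec_diagonal, Pi.smul_apply, smul_eq_mul, sub_mul]
  have h3 : star x ⬝ᵥ (A k *ᵥ x) - lam k = star x ⬝ᵥ (A k *ᵥ x - lam k • x) := by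
    rw [dotProduct_sub, dotProduct_smul, star_dotProduct_self hx, smul_eq_mul, mul_one]
  simp only [rq1, PiLp.sub_apply]
  rw [h3, h1, dotProduct_mulVec, ← conjTranspose_conjTranspose X₂, ← star_mulVec,
    conjTranspose_conjTranspose]
  simp only [dotProduct, WithLp.ofLp_sum, Finset.sum_apply]
  refine Finset.sum_congr rfl fun j _ => ?_
  simp
  ring

theorem left₂_linComb (h : IsDiagonalSplitting A lam X₁ Y₁ X₂ Y₂ D)
    (μ : EuclideanSpace ℂ (Fin d)) (x : Fin n → ℂ) (j : Fin (n - p)) :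
    (Y₂ᴴ *ᵥ (linComb A μ *ᵥ x)) j = linCombEig (D j) μ * (Y₂ᴴ *ᵥ x) j := by
  rw [linComb_mulVec, mulVec_sum]
  simp only [mulVec_smul, mulVec_mulVec, h.left₂]
  simp only [← mulVec_mulVec, Finset.sum_apply, Pi.smul_apply, mulVec_diagonal, linCombEig,
    Finset.sum_mul, smul_eq_mul, mul_assoc]

theorem left₁_linComb (h : IsDiagonalSplitting A lam X₁ Y₁ X₂ Y₂ D)
    (μ : EuclideanSpace ℂ (Fin d)) (x : Fin n → ℂ) :
    Y₁ᴴ *ᵥ (linComb A μ *ᵥ x) = linCombEig lam μ • (Y₁ᴴ *ᵥ x) := by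
  rw [linComb_mulVec, mulVec_sum]
  simp only [mulVec_smul, mulVec_mulVec, h.left₁, smul_mulVec, linCombEig, Finset.sum_smul,
    mul_smul]

/-- The Rayleigh quotient error for an eigenvector of the perturbed pencil whose eigenvalue stays
close to the unperturbed one. -/
theorem norm_rq1_sub_le (h : IsDiagonalSplitting A lam X₁ Y₁ X₂ Y₂ D)
    (hE : ∑ k, ∑ r, ∑ s, ‖E k r s‖ ^ 2 = 1) {μ : EuclideanSpace ℂ (Fin d)} (hμ : ‖μ‖ = 1)
    {R : ℝ} (hR : 0 ≤ R) {g : ℝ} (hg : 0 < g)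
    (hgap : ∀ j, g ≤ ‖linCombEig (D j - lam) μ‖)
    (hD : ∀ j, ‖D j - lam‖ ≤ R * ‖linCombEig (D j - lam) μ‖)
    {ε : ℝ} (hε : 0 ≤ ε) {x : Fin n → ℂ} (hx : ‖WithLp.toLp 2 x‖ = 1) {θ : ℂ}
    (hθ : linComb (perturbed A E ε) μ *ᵥ x = θ • x)
    (hnear : ‖θ - linCombEig lam μ‖ ≤ g / 2) :
    ‖rq1 (perturbed A E ε) x - lam‖ ≤ (1 + ‖X₂‖ * ‖Y₂‖ * R) * ε +
      R * (‖X₁‖ * ‖Y₁‖ + ‖X₂‖ * ‖Y₂‖) * (‖X₂‖ * (2 / g * ‖Y₂‖)) * ε ^ 2 := by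
  set a := Y₁ᴴ *ᵥ x with ha
  set b := Y₂ᴴ *ᵥ x with hb
  set w := X₂ᴴ *ᵥ x with hw
  set f := linComb E μ *ᵥ x with hf
  set c := Y₂ᴴ *ᵥ f with hc
  set τ := θ - linCombEig lam μ with hτ
  have hfn : ‖WithLp.toLp 2 f‖ ≤ 1 := norm_linComb_mulVec_le hE hx hμ
  have hcn : ‖WithLp.toLp 2 c‖ ≤ ‖Y₂‖ := by
    refine (norm_toLp_mulVec_le _ _).trans ?_
    rw [l2_opNorm_conjTranspose]
    exact mul_le_of_le_one_right (norm_nonneg _) hfn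
  have hwn : ‖WithLp.toLp 2 w‖ ≤ ‖X₂‖ := by
    refine (norm_toLp_mulVec_le _ _).trans ?_
    rw [l2_opNorm_conjTranspose, hx, mul_one]
  rw [linComb_perturbed, add_mulVec, smul_mulVec] at hθ
  have hbj : ∀ j, linCombEig (D j - lam) μ * b j = τ * b j - ε * c j := by
    intro j
    have h1 := congrFun (congrArg (Y₂ᴴ *ᵥ ·) hθ) j
    simp only [mulVec_add, mulVec_smul, Pi.add_apply, Pi.smul_apply, smul_eq_mul,
      h.left₂_linComb] at h1
    rw [linCombEig_sub]
    linear_combination h1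
  -- Since `‖τ‖ ≤ g / 2`, the term `τ * b j` absorbs at most half of the gap, which leaves the
  -- factor `2 / g`.
  have hbn : ‖WithLp.toLp 2 b‖ ≤ 2 / g * ε * ‖Y₂‖ := by
    have h2 : ∀ j, ‖b j‖ ≤ ‖(((2 / g * ε : ℝ) : ℂ) • c) j‖ := by
      intro j
      have h3 : g * ‖b j‖ ≤ g / 2 * ‖b j‖ + ε * ‖c j‖ := by
        calc g * ‖b j‖ ≤ ‖linCombEig (D j - lam) μ‖ * ‖b j‖ := by gcongr; exact hgap j
          _ = ‖τ * b j - ε * c j‖ := by rw [← norm_mul, hbj]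
          _ ≤ ‖τ‖ * ‖b j‖ + ε * ‖c j‖ := by
            refine (norm_sub_le _ _).trans (le_of_eq ?_)
            rw [norm_mul, norm_mul, Complex.norm_real, Real.norm_of_nonneg hε]
          _ ≤ _ := by gcongr
      rw [Pi.smul_apply, norm_smul, Complex.norm_real, Real.norm_of_nonneg (by positivity)]
      have h4 : ‖b j‖ = 2 / g * (g / 2 * ‖b j‖) := by field_simp
      rw [h4, mul_assoc]
      exact mul_le_mul_of_nonneg_left (by linarith) (by positivity)
    have h5 : ‖WithLp.toLp 2 b‖ ≤ ‖WithLp.toLp 2 (((2 / g * ε : ℝ) : ℂ) • c)‖ := by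
      rw [EuclideanSpace.norm_eq, EuclideanSpace.norm_eq]
      exact Real.sqrt_le_sqrt (Finset.sum_le_sum fun j _ =>
        pow_le_pow_left₀ (norm_nonneg _) (h2 j) 2)
    rw [WithLp.toLp_smul, norm_smul, Complex.norm_real, Real.norm_of_nonneg (by positivity)] at h5
    exact h5.trans (by gcongr)
  have hτn : ‖τ‖ ≤ ε * (‖X₁‖ * ‖Y₁‖ + ‖X₂‖ * ‖Y₂‖) := by
    have h1 : τ • a = (ε : ℂ) • (Y₁ᴴ *ᵥ f) := by
      have h2 := congrArg (Y₁ᴴ *ᵥ ·) hθ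
      simp only [mulVec_add, mulVec_smul, h.left₁_linComb] at h2
      rw [hτ, sub_smul, ← h2, add_sub_cancel_left]
    have h3 : ‖τ‖ * ‖WithLp.toLp 2 a‖ ≤ ε * ‖Y₁‖ := by
      rw [← norm_smul, ← WithLp.toLp_smul, h1, WithLp.toLp_smul, norm_smul, Complex.norm_real,
        Real.norm_of_nonneg hε]
      refine mul_le_mul_of_nonneg_left ((norm_toLp_mulVec_le _ _).trans ?_) hε
      rw [l2_opNorm_conjTranspose]
      exact mul_le_of_le_one_right (norm_nonneg _) hfn
    -- Multiplying this by `‖τ‖` avoids a lower bound on `a`: the first term is controlled by `τ a =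
    -- ε Y₁* f`, the second by `‖τ‖ ≤ g / 2` and the bound on `b`.
    have h4 : 1 ≤ ‖X₁‖ * ‖WithLp.toLp 2 a‖ + ‖X₂‖ * ‖WithLp.toLp 2 b‖ := by
      calc 1 = ‖WithLp.toLp 2 (X₁ *ᵥ a) + WithLp.toLp 2 (X₂ *ᵥ b)‖ := by
            rw [← WithLp.toLp_add, h.resolution_mulVec, hx]
        _ ≤ _ := (norm_add_le _ _).trans
            (add_le_add (norm_toLp_mulVec_le _ _) (norm_toLp_mulVec_le _ _))
    calc ‖τ‖ = ‖τ‖ * 1 := (mul_one _).symm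
      _ ≤ ‖τ‖ * (‖X₁‖ * ‖WithLp.toLp 2 a‖ + ‖X₂‖ * ‖WithLp.toLp 2 b‖) := by gcongr
      _ = ‖X₁‖ * (‖τ‖ * ‖WithLp.toLp 2 a‖) + ‖τ‖ * (‖X₂‖ * ‖WithLp.toLp 2 b‖) := by ring
      _ ≤ ‖X₁‖ * (ε * ‖Y₁‖) + g / 2 * (‖X₂‖ * (2 / g * ε * ‖Y₂‖)) := by gcongr
      _ = _ := by field_simp
  have hmain : ‖rq1 A x - lam‖ ≤
      R * (ε * (‖X₂‖ * ‖Y₂‖) + ‖τ‖ * (‖X₂‖ * (2 / g * ε * ‖Y₂‖))) := by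
    rw [h.rq1_sub hx]
    refine (norm_sum_le _ _).trans ?_
    have h1 : ∀ j, ‖(star (w j) * b j) • (D j - lam)‖ ≤
        R * (ε * (‖w j‖ * ‖c j‖) + ‖τ‖ * (‖w j‖ * ‖b j‖)) := by
      intro j
      rw [norm_smul, norm_mul, norm_star]
      calc ‖w j‖ * ‖b j‖ * ‖D j - lam‖ ≤
            ‖w j‖ * ‖b j‖ * (R * ‖linCombEig (D j - lam) μ‖) := by gcongr; exact hD j
        -- The divisor disappears here: its product with `b j` is known from the eigenvector
        -- equation, so `1 / g` enters only the second-order term.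
        _ = R * ‖w j‖ * ‖τ * b j - ε * c j‖ := by rw [← hbj, norm_mul]; ring
        _ ≤ R * ‖w j‖ * (‖τ‖ * ‖b j‖ + ε * ‖c j‖) := by
          gcongr
          refine (norm_sub_le _ _).trans (le_of_eq ?_)
          rw [norm_mul, norm_mul, Complex.norm_real, Real.norm_of_nonneg hε]
        _ = _ := by ring
    refine (Finset.sum_le_sum fun j _ => h1 j).trans ?_
    rw [← Finset.mul_sum, Finset.sum_add_distrib, ← Finset.mul_sum, ← Finset.mul_sum]
    have h2 : ∑ j, ‖w j‖ * ‖c j‖ ≤ ‖X₂‖ * ‖Y₂‖ :=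
      (sum_norm_mul_norm_le w c).trans (by gcongr)
    have h3 : ∑ j, ‖w j‖ * ‖b j‖ ≤ ‖X₂‖ * (2 / g * ε * ‖Y₂‖) :=
      (sum_norm_mul_norm_le w b).trans (by gcongr)
    gcongr
  have h6 : ‖rq1 A x - lam‖ ≤ R * (ε * (‖X₂‖ * ‖Y₂‖) +
      ε * (‖X₁‖ * ‖Y₁‖ + ‖X₂‖ * ‖Y₂‖) * (‖X₂‖ * (2 / g * ε * ‖Y₂‖))) :=
    hmain.trans (by gcongr)
  refine (norm_rq1_perturbed_sub_le A hE lam hε hx).trans ((add_le_add h6 le_rfl).trans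
    (le_of_eq ?_))
  ring

end IsDiagonalSplitting

end

/-! ### The diagonal splitting and the multiplicity of `λ(μ)`. -/

variable {n d p : ℕ} {A E : Fin d → Matrix (Fin n) (Fin n) ℂ} {lam : EuclideanSpace ℂ (Fin d)}
  {X₁ Y₁ : Matrix (Fin n) (Fin p) ℂ} {X₂ Y₂ : Matrix (Fin n) (Fin (n - p)) ℂ}
  {D : Fin (n - p) → EuclideanSpace ℂ (Fin d)}

theorem IsSemisimpleJointEigenvalue.le (hlam : IsSemisimpleJointEigenvalue A lam p) : p ≤ n := by
  rw [← hlam.geometric]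
  simpa using Submodule.finrank_le (commonEigenspace A lam)

theorem IsBlockDiagonalization.mul_conjTranspose
    (hXY : IsBlockDiagonalization A lam X₁ Y₁ X₂ Y₂) (hp : p ≤ n) :
    fromCols X₁ X₂ * (fromCols Y₁ Y₂)ᴴ = 1 := by
  refine (mul_eq_one_comm_of_card_eq _ _ _ ?_).1 hXY.biorthogonal
  simp [hp]

theorem IsBlockDiagonalization.exists_isDiagonalSplitting
    (hXY : IsBlockDiagonalization A lam X₁ Y₁ X₂ Y₂) (hp : p ≤ n)
    (hdiag : ∀ k, ((fromCols Y₁ Y₂)ᴴ * A k * fromCols X₁ X₂).IsDiag) :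
    ∃ D, IsDiagonalSplitting A lam X₁ Y₁ X₂ Y₂ D := by
  have hres := hXY.mul_conjTranspose hp
  choose B hB using hXY.block
  have hBd : ∀ k, B k = diagonal fun j => B k j j := by
    intro k
    ext i j
    by_cases hij : i = j
    · simp [hij]
    · rw [diagonal_apply_ne _ hij]
      have h := hdiag k (i := Sum.inr i) (j := Sum.inr j) (by simpa using hij)
      rwa [hB k] at h
  have hleft : ∀ k, (fromCols Y₁ Y₂)ᴴ * A k =
      fromBlocks (lam k • (1 : Matrix (Fin p) (Fin p) ℂ)) 0 0 (B k) * (fromCols Y₁ Y₂)ᴴ := by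
    intro k
    rw [← hB k, Matrix.mul_assoc _ (fromCols X₁ X₂), hres, Matrix.mul_one]
  have hright : ∀ k, A k * fromCols X₁ X₂ =
      fromCols X₁ X₂ * fromBlocks (lam k • (1 : Matrix (Fin p) (Fin p) ℂ)) 0 0 (B k) := by
    intro k
    rw [← hB k, ← Matrix.mul_assoc, ← Matrix.mul_assoc, hres, Matrix.one_mul]
  simp only [conjTranspose_fromCols_eq_fromRows_conjTranspose, fromRows_mul,
    fromBlocks_mul_fromRows, fromRows_inj.eq_iff, mul_fromCols, fromCols_mul_fromBlocks,
    Matrix.zero_mul, Matrix.mul_zero, add_zero, zero_add, Matrix.smul_mul, Matrix.mul_smul, Matrix.one_mul,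
    Matrix.mul_one, fromCols_inj.eq_iff, fromCols_mul_fromRows] at hleft hright hres
  exact ⟨fun j => WithLp.toLp 2 fun k => B k j j, fun k => (hleft k).1,
    fun k => (hleft k).2.trans (congrArg (· * Y₂ᴴ) (hBd k)), fun k => (hright k).1,
    fun k => (hright k).2.trans (congrArg (X₂ * ·) (hBd k)), hres⟩

/-- Otherwise the `j`-th column of `X₂` and the `p` columns of `X₁` would be `p + 1` independent
vectors in a common eigenspace of dimension `p`. -/
theorem IsDiagonalSplitting.ne (h : IsDiagonalSplitting A lam X₁ Y₁ X₂ Y₂ D)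
    (hbi : (fromCols Y₁ Y₂)ᴴ * fromCols X₁ X₂ = 1)
    (hgeom : Module.finrank ℂ (commonEigenspace A lam) = p) (j : Fin (n - p)) : D j ≠ lam := by
  intro hj
  let ι : (Fin p ⊕ Unit → ℂ) →ₗ[ℂ] (Fin p ⊕ Fin (n - p) → ℂ) :=
    { toFun := fun v => Sum.elim (fun i => v (Sum.inl i)) (Pi.single j (v (Sum.inr ())))
      map_add' := by
        intro v w
        ext (i | i) <;> simp [Pi.single_add]
      map_smul' := by
        intro c v
        ext (i | i)
        · simp
        · simp only [Sum.elim_inr, Pi.smul_apply, RingHom.id_apply, Pi.single_smul] }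
  have hι : Function.Injective ι := by
    intro v w hvw
    ext (i | i)
    · exact congrFun hvw (Sum.inl i)
    · simpa [ι] using congrFun hvw (Sum.inr j)
  let f : (Fin p ⊕ Unit → ℂ) →ₗ[ℂ] (Fin n → ℂ) := (fromCols X₁ X₂).mulVecLin ∘ₗ ι
  have hf : Function.Injective f := by
    refine Function.Injective.comp (g := (fromCols X₁ X₂).mulVecLin) ?_ hι
    intro v w hvw
    have h1 := congrArg ((fromCols Y₁ Y₂)ᴴ *ᵥ ·) hvw
    simp only [mulVecLin_apply, mulVec_mulVec, hbi, one_mulVec] at h1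
    exact h1
  have hrange : LinearMap.range f ≤ commonEigenspace A lam := by
    rintro _ ⟨v, rfl⟩
    simp only [commonEigenspace, Submodule.mem_iInf, LinearMap.mem_ker, toLin'_apply]
    intro k
    change (A k - lam k • 1) *ᵥ (fromCols X₁ X₂ *ᵥ Sum.elim _ _) = 0
    rw [fromCols_mulVec_sumElim, sub_mulVec, mulVec_add, mulVec_mulVec, mulVec_mulVec, h.right₁,
      h.right₂, ← mulVec_mulVec, smul_mulVec, smul_mulVec, one_mulVec, smul_add,
      add_sub_add_left_eq_sub, ← mulVec_smul, ← mulVec_sub]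
    convert mulVec_zero X₂
    ext i
    rw [Pi.sub_apply, mulVec_diagonal, Pi.smul_apply]
    by_cases hij : i = j
    · simp [hij, hj]
    · simp [hij]
  have h1 := Submodule.finrank_mono hrange
  rw [LinearMap.finrank_range_of_inj hf, hgeom] at h1
  simp at h1

open Polynomial in
theorem IsDiagonalSplitting.le_rootMultiplicity (h : IsDiagonalSplitting A lam X₁ Y₁ X₂ Y₂ D)
    (hp : p ≤ n) (hbi : (fromCols Y₁ Y₂)ᴴ * fromCols X₁ X₂ = 1)
    (hres : fromCols X₁ X₂ * (fromCols Y₁ Y₂)ᴴ = 1) (μ : EuclideanSpace ℂ (Fin d)) :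
    p ≤ (linComb A μ).charpoly.rootMultiplicity (linCombEig lam μ) := by
  set z := linCombEig lam μ with hz
  have h1 : linComb A μ * X₁ = z • X₁ := by
    simp only [linComb, Matrix.sum_mul, smul_mul, h.right₁, smul_smul, hz, linCombEig,
      Finset.sum_smul]
  have h2 : linComb A μ * X₂ = X₂ * ∑ k, μ k • diagonal fun j => D j k := by
    simp only [linComb, Matrix.sum_mul, smul_mul, h.right₂, Matrix.mul_sum, Matrix.mul_smul]
  set N := ∑ k, μ k • diagonal fun j => D j k
  have h3 : linComb A μ * fromCols X₁ X₂ =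
      fromCols X₁ X₂ * fromBlocks (z • (1 : Matrix (Fin p) (Fin p) ℂ)) 0 0 N := by
    rw [mul_fromCols, fromCols_mul_fromBlocks, h1, h2]
    simp
  -- Similarity through matrices whose row and column index types differ: the powers of `X` on the
  -- two sides have equal exponents and cancel.
  have h4 := charpoly_mul_comm' (linComb A μ * fromCols X₁ X₂) (fromCols Y₁ Y₂)ᴴ
  have h5 : Fintype.card (Fin p ⊕ Fin (n - p)) = Fintype.card (Fin n) := by simp [hp]
  rw [h5] at h4
  have h6 := (isRegular_X_pow _).left h4
  rw [Matrix.mul_assoc, hres, Matrix.mul_one, h3, ← Matrix.mul_assoc, hbi, Matrix.one_mul,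
    charpoly_fromBlocks_zero₁₂, smul_one_eq_diagonal, charpoly_diagonal] at h6
  rw [le_rootMultiplicity_iff (charpoly_monic _).ne_zero, h6]
  simp

/-- If some `θ i` were outside the disc, so would be every remaining eigenvalue, and at most `p - 1`
eigenvalues would lie inside. -/
theorem AreClosestEigenvalues.norm_sub_lt {M : Matrix (Fin n) (Fin n) ℂ} {z : ℂ} {θ : Fin p → ℂ}
    (h : AreClosestEigenvalues M z θ) {r : ℝ}
    (hr : p ≤ M.charpoly.roots.countP (fun w => ‖w - z‖ < r)) (i : Fin p) : ‖θ i - z‖ < r := by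
  obtain ⟨rest, hroots, hrest⟩ := h
  by_contra hi
  have h0 : rest.countP (fun w => ‖w - z‖ < r) = 0 :=
    Multiset.countP_eq_zero.2 fun w hw hlt => hi ((hrest i w hw).trans_lt hlt)
  rw [hroots, Multiset.countP_add, h0, add_zero] at hr
  have hcard : (Finset.univ.val.map θ).card = p := by simp
  have h1 := Multiset.countP_eq_card.1
    (le_antisymm (Multiset.countP_le_card _ _) (hcard.trans_le hr))
  exact hi (h1 (θ i) (by simp))

/-! ### Good directions and the final estimate. -/

/-- The directions `μ` for which no `δ j` is nearly orthogonal to `μ` have large probability. -/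
theorem one_sub_le_unifSphere_real {m : ℕ} (hd : 0 < d) (δ : Fin m → EuclideanSpace ℂ (Fin d))
    {R : ℝ} (hR : 0 < R) :
    MeasurableSet {μ : Metric.sphere (0 : EuclideanSpace ℂ (Fin d)) 1 |
      ∀ j, ‖δ j‖ ≤ R * ‖linCombEig (δ j) μ‖} ∧
    1 - m * d / R ^ 2 ≤ (unifSphere d).real {μ | ∀ j, ‖δ j‖ ≤ R * ‖linCombEig (δ j) μ‖} := by
  have hprob := isProbabilityMeasure_unifSphere hd
  set S := {μ : Metric.sphere (0 : EuclideanSpace ℂ (Fin d)) 1 |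
    ∀ j, ‖δ j‖ ≤ R * ‖linCombEig (δ j) μ‖} with hS
  have hmeas : MeasurableSet S := by
    refine IsClosed.measurableSet ?_
    rw [hS, Set.ofPred_forall]
    refine isClosed_iInter fun j => isClosed_le continuous_const ?_
    unfold linCombEig
    fun_prop
  refine ⟨hmeas, ?_⟩
  set T : Fin m → Set (Metric.sphere (0 : EuclideanSpace ℂ (Fin d)) 1) := fun j =>
    {μ | ¬ ‖δ j‖ ≤ R * ‖linCombEig (δ j) μ‖} with hT
  have hTj : ∀ j, (unifSphere d).real (T j) ≤ d * (1 / R) ^ 2 := by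
    intro j
    by_cases hj : δ j = 0
    · have : T j = ∅ := by
        ext μ
        simp [hT, hj]
        positivity
      rw [this, measureReal_empty]
      positivity
    · have hj' : 0 < ‖δ j‖ := norm_pos_iff.2 hj
      -- `linCombEig` is bilinear whereas the inner product is conjugate-linear in its first
      -- argument, hence the conjugated entries.
      set u : EuclideanSpace ℂ (Fin d) :=
        ((‖δ j‖⁻¹ : ℝ) : ℂ) • WithLp.toLp 2 fun k => star (δ j k) with hu
      have hu1 : ‖u‖ = 1 := by
        have : ‖WithLp.toLp 2 fun k => star (δ j k)‖ = ‖δ j‖ := by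
          simp [EuclideanSpace.norm_eq]
        rw [hu, norm_smul, this, Complex.norm_real, Real.norm_of_nonneg (by positivity),
          inv_mul_cancel₀ hj'.ne']
      refine le_trans (measureReal_mono ?_) (unifSphere_slab_le hd hu1 (by positivity))
      intro μ hμ
      have hμ' : R * ‖linCombEig (δ j) μ‖ < ‖δ j‖ := not_le.1 hμ
      have hin : inner ℂ u (μ : EuclideanSpace ℂ (Fin d)) =
          ((‖δ j‖⁻¹ : ℝ) : ℂ) * linCombEig (δ j) μ := by
        rw [hu, inner_smul_left, Complex.conj_ofReal]
        congr 1
        simp [PiLp.inner_apply, linCombEig]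
      change ‖inner ℂ u (μ : EuclideanSpace ℂ (Fin d))‖ < 1 / R
      rw [hin, norm_mul, Complex.norm_real, Real.norm_of_nonneg (by positivity), lt_div_iff₀ hR,
        inv_mul_eq_div, div_mul_eq_mul_div, div_lt_one hj', mul_comm]
      exact hμ'
  have hcompl : Sᶜ ⊆ ⋃ j, T j := by
    intro μ hμ
    simpa [hS, hT] using hμ
  have h1 : (unifSphere d).real Sᶜ ≤ m * (d * (1 / R) ^ 2) :=
    calc (unifSphere d).real Sᶜ ≤ (unifSphere d).real (⋃ j, T j) := measureReal_mono hcompl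
      _ ≤ ∑ j, (unifSphere d).real (T j) := measureReal_iUnion_fintype_le _
      _ ≤ ∑ _j : Fin m, d * (1 / R) ^ 2 := Finset.sum_le_sum fun j _ => hTj j
      _ = _ := by simp
  rw [probReal_compl_eq_one_sub hmeas] at h1
  have h2 : (m : ℝ) * (d * (1 / R) ^ 2) = m * d / R ^ 2 := by ring
  linarith

theorem IsDiagonalSplitting.exists_norm_rq1_sub_le (h : IsDiagonalSplitting A lam X₁ Y₁ X₂ Y₂ D)
    (hE : ∑ k, ∑ r, ∑ s, ‖E k r s‖ ^ 2 = 1) (hne : ∀ j, D j ≠ lam)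
    {μ : EuclideanSpace ℂ (Fin d)} (hμ : ‖μ‖ = 1)
    (hroot : p ≤ (linComb A μ).charpoly.rootMultiplicity (linCombEig lam μ))
    {R : ℝ} (hR : 0 < R) (hD : ∀ j, ‖D j - lam‖ ≤ R * ‖linCombEig (D j - lam) μ‖) (i : Fin p) :
    ∃ C : ℝ, ∀ ε : ℝ, 0 < ε → ∀ (Xt Yt : Matrix (Fin n) (Fin p) ℂ) (θ : Fin p → ℂ),
      IsClosestEigenbasis (linComb (perturbed A E ε) μ) (linCombEig lam μ) Xt Yt θ →
      ‖rq1 (perturbed A E ε) (Xt.col i) - lam‖ ≤ (1 + ‖X₂‖ * ‖Y₂‖ * R) * ε + C * ε ^ 2 := by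
  obtain ⟨g, hg, hgap⟩ : ∃ g : ℝ, 0 < g ∧ ∀ j, g ≤ ‖linCombEig (D j - lam) μ‖ := by
    have hpos : ∀ j, 0 < ‖linCombEig (D j - lam) μ‖ := fun j =>
      pos_of_mul_pos_right ((norm_pos_iff.2 (sub_ne_zero.2 (hne j))).trans_le (hD j)) hR.le
    rcases isEmpty_or_nonempty (Fin (n - p)) with he | he
    -- If the second block is empty, any positive gap will do.
    · exact ⟨1, one_pos, fun j => he.elim j⟩
    · obtain ⟨j, hj⟩ := Finite.exists_min fun j => ‖linCombEig (D j - lam) μ‖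
      exact ⟨_, hpos j, hj⟩
  have hcont : Continuous fun ε : ℝ => linComb (perturbed A E ε) μ := by
    simp only [linComb_perturbed]
    fun_prop
  have hev := eventually_rootMultiplicity_le_countP _ hcont (linCombEig lam μ) (half_pos hg)
  obtain ⟨ε₀, hε₀, hball⟩ := Metric.eventually_nhds_iff.1 hev
  set C₁ := R * (‖X₁‖ * ‖Y₁‖ + ‖X₂‖ * ‖Y₂‖) * (‖X₂‖ * (2 / g * ‖Y₂‖)) with hC₁
  set K := (∑ k, ‖A k‖) + ‖lam‖ with hK
  have hC₁0 : 0 ≤ C₁ := by positivity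
  have hK0 : 0 ≤ K := by positivity
  -- `C₁` serves `ε < ε₀`, where the eigenvalues stay within `g / 2`. For `ε ≥ ε₀` the error is at
  -- most `K + ε`, and `K ≤ (K / ε₀²) ε²`.
  refine ⟨C₁ + K / ε₀ ^ 2, fun ε hε Xt Yt θ hX => ?_⟩
  have hx := hX.norm_col i
  have hsplit : 0 ≤ ‖X₂‖ * ‖Y₂‖ * R * ε := by positivity
  rcases lt_or_ge ε ε₀ with hlt | hge
  · have hcount := hball (y := ε) (by rwa [Real.dist_eq, sub_zero, abs_of_pos hε])
    have hzero : linComb (perturbed A E 0) μ = linComb A μ := by simp [linComb_perturbed]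
    rw [hzero] at hcount
    have hnear := hX.closest.norm_sub_lt (hroot.trans hcount) i
    have heig : linComb (perturbed A E ε) μ *ᵥ Xt.col i = θ i • Xt.col i := by
      have h1 := congrArg (fun M : Matrix (Fin n) (Fin p) ℂ => M.col i) hX.right
      ext r
      have h2 := congrFun h1 r
      rw [col_apply, col_apply, mul_diagonal, mul_comm] at h2
      exact h2
    refine (h.norm_rq1_sub_le hE hμ hR.le hg hgap hD hε.le hx heig hnear.le).trans ?_
    have : 0 ≤ K / ε₀ ^ 2 * ε ^ 2 := by positivity
    linarith
  · refine (norm_rq1_perturbed_sub_le A hE lam hε.le hx).trans ?_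
    have h1 := norm_rq1_sub_le_sum A lam hx
    have h2 : K ≤ K / ε₀ ^ 2 * ε ^ 2 := by
      rw [div_mul_eq_mul_div, le_div_iff₀ (by positivity)]
      gcongr
    have h3 : 0 ≤ C₁ * ε ^ 2 := by positivity
    linarith

end JointEig

end

/-- `‖X₂‖`, `‖Y₂‖` are spectral norms. The probability bound is stated through a measurable set `S`
contained in the event, so that it also bounds the probability of the event itself. -/
theorem theorem4 {n d p : ℕ} (hd : 2 ≤ d)
    (A : Fin d → Matrix (Fin n) (Fin n) ℂ) (hA : ∀ j k, Commute (A j) (A k))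
    (lam : EuclideanSpace ℂ (Fin d)) (hlam : JointEig.IsSemisimpleJointEigenvalue A lam p)
    (X₁ Y₁ : Matrix (Fin n) (Fin p) ℂ) (X₂ Y₂ : Matrix (Fin n) (Fin (n - p)) ℂ)
    (hXY : JointEig.IsBlockDiagonalization A lam X₁ Y₁ X₂ Y₂)
    (hdiag : ∀ k, ((Matrix.fromCols Y₁ Y₂)ᴴ * A k * Matrix.fromCols X₁ X₂).IsDiag)
    (E : Fin d → Matrix (Fin n) (Fin n) ℂ)
    (hE : ∑ k, ∑ r, ∑ s, ‖E k r s‖ ^ 2 = 1)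
    (R : ℝ) (hR : 0 < R) (i : Fin p) :
    ∃ S : Set (Metric.sphere (0 : EuclideanSpace ℂ (Fin d)) 1),
      MeasurableSet S ∧
      1 - ((n : ℝ) - p) * ((d : ℝ) - 1) * d / R ^ 2 ≤ (JointEig.unifSphere d).real S ∧
      ∀ μ ∈ S, ∃ C : ℝ, ∀ ε : ℝ, 0 < ε →
        ∀ (Xt Yt : Matrix (Fin n) (Fin p) ℂ) (θ : Fin p → ℂ),
          JointEig.IsClosestEigenbasis
            (JointEig.linComb (JointEig.perturbed A E ε) μ) (JointEig.linCombEig lam μ)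
            Xt Yt θ →
          ‖JointEig.rq1 (JointEig.perturbed A E ε) (Xt.col i) - lam‖
            ≤ (1 + ‖X₂‖ * ‖Y₂‖ * R) * ε + C * ε ^ 2 := by
  have hp := hlam.le
  obtain ⟨D, hsplit⟩ := hXY.exists_isDiagonalSplitting hp hdiag
  have hne := hsplit.ne hXY.biorthogonal hlam.geometric
  obtain ⟨hmeas, hprob⟩ := JointEig.one_sub_le_unifSphere_real (by omega : 0 < d)
    (fun j => D j - lam) hR
  refine ⟨_, hmeas, le_trans ?_ hprob, fun μ hμ => ?_⟩
  -- The union bound has no factor `d - 1`; inserting it only weakens the estimate because `d ≥ 2`.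
  · rw [Nat.cast_sub hp]
    have h1 : (1 : ℝ) ≤ (d : ℝ) - 1 := by
      have : (2 : ℝ) ≤ d := by exact_mod_cast hd
      linarith
    have h2 : (0 : ℝ) ≤ (n : ℝ) - p := sub_nonneg.2 (by exact_mod_cast hp)
    gcongr
    exact le_mul_of_one_le_right h2 h1
  · exact hsplit.exists_norm_rq1_sub_le hE hne (by simp)
      (hsplit.le_rootMultiplicity hp hXY.biorthogonal (hXY.mul_conjTranspose hp) μ) hR hμ i
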